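/- Let $f:\mathbb{R}\to\mathbb{R}$ be of class $C^3$ on $[0,\infty)$ with $f(1)=0$ and $f'(1)<0$. Set $c_s=\sqrt{-2f'(1)}$ and $F(\rho)=\int_\rho^1 f(r)\,dr$, and assume that $$\frac{c_s^2}{4}(1-\rho)^2\le F(\rho)\quad\text{for all }\rho\ge 0,\qquad k:=2f''(1)+6f'(1)<0 .$$ For $c\in(0,c_s)$, a travelling wave of speed $c$ is a non-constant, non-vanishing $C^2$ function $u:\mathbb{R}\to\mathbb{C}$ with $-icu'+u''+u\,f(|u|^2)=0$, $u'\in L^2(\mathbb{R})$ and $F(|u|^2)\in L^1(\mathbb{R})$. For such a wave $u=\mathfrak{u}_c$ put $\eta_c=1-|\mathfrak{u}_c|^2$, $B_c=1-\eta_c$, $m_{1,c}=-\eta_c'/\eta_c$, $m_{2,c}=-\dfrac{c\,\eta_c'}{2(1-\eta_c)^2}$, and $$q_{1,c}=2(m_{1,c}B_c)',\qquad q_{3,c}=4m_{2,c}B_c,\qquad \widetilde{q_{1,c}}=-\frac{q_{3,c}^2}{4q_{1,c}}+\frac{m_{1,c}'}{B_c}+\Big(\frac{m_{1,c}}{2B_c}\Big)'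 .$$ Then for every $c_0\in(0,c_s)$ there exist $c_1\in(c_0,c_s)$ and $\delta>0$ such that, for all $c\in(c_1,c_s)$, every travelling wave of speed $c$ and all $x\in\mathbb{R}$, $$\frac{q_{1,c}(x)}{\eta_c(x)}>0\qquad\text{and}\qquad \frac{\widetilde{q_{1,c}}(x)}{\eta_c(x)}\ge\delta .$$ The second bound also holds when $\widetilde{q_{1,c}}$ is replaced by $$-\frac{3}{2(1-\eta_c)}\Big(\frac{\eta_c'}{\eta_c}\Big)'-\frac{(\eta_c')^2}{2\eta_c(1-\eta_c)^2}-\frac{c^2(\eta_c')^2}{(1-\eta_c)\,q_{1,c}} ,$$ which differs from $\widetilde{q_{1,c}}$ only by a factor $1-\eta_c$ in its last term. -/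

import Mathlib

noncomputable section

namespace TransonicNLS

/-- The potential `F(ρ) = ∫_ρ^1 f(r) dr`. -/
def potential (f : ℝ → ℝ) (ρ : ℝ) : ℝ := ∫ r in ρ..1, f r

/-- The sound speed `c_s = √(-2 f'(1))`. -/
def soundSpeed (f : ℝ → ℝ) : ℝ := Real.sqrt (-2 * deriv f 1)

/-- `u` is the profile of a travelling wave of speed `c` of `i ∂ₜΨ + ∂ₓ²Ψ + Ψ f(|Ψ|²) = 0`:
a non-constant, non-vanishing classical solution of
`-i c u' + u'' + u f(|u|²) = 0` that lies in the energy set, i.e. `u' ∈ L²` and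
`F(|u|²) ∈ L¹`. -/
structure IsTravellingWave (f : ℝ → ℝ) (c : ℝ) (u : ℝ → ℂ) : Prop where
  contDiff : ContDiff ℝ 2 u
  equation : ∀ x : ℝ,
    -(Complex.I * (c : ℂ) * deriv u x) + deriv (deriv u) x
      + u x * ((f (‖u x‖ ^ 2) : ℝ) : ℂ) = 0
  ne_zero : ∀ x : ℝ, u x ≠ 0
  nonconstant : ∃ x y : ℝ, u x ≠ u y
  deriv_memLp : MeasureTheory.MemLp (deriv u) 2 MeasureTheory.volume
  potential_integrable :
    MeasureTheory.Integrable (fun x => potential f (‖u x‖ ^ 2)) MeasureTheory.volume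

/-- The hydrodynamical variable `η = 1 - |u|²`. -/
def eta (u : ℝ → ℂ) (x : ℝ) : ℝ := 1 - ‖u x‖ ^ 2

/-! In what follows `η` is the hydrodynamical variable of a wave of speed `c`. -/

/-- `B = 1 - η`. -/
def B (η : ℝ → ℝ) (x : ℝ) : ℝ := 1 - η x

/-- `m₁ = -η' / η`, the diagonal entry of the virial matrix. -/
def m₁ (η : ℝ → ℝ) (x : ℝ) : ℝ := -(deriv η x / η x)

/-- `m₂ = -c η' / (2 (1 - η)²)`, the off-diagonal entry of the virial matrix. -/
def m₂ (c : ℝ) (η : ℝ → ℝ) (x : ℝ) : ℝ := -(c * deriv η x / (2 * (1 - η x) ^ 2))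

/-- `q₁ = 2 (m₁ B)'`. -/
def q₁ (η : ℝ → ℝ) (x : ℝ) : ℝ := 2 * deriv (fun y => m₁ η y * B η y) x

/-- `q₃ = 4 m₂ B`. -/
def q₃ (c : ℝ) (η : ℝ → ℝ) (x : ℝ) : ℝ := 4 * m₂ c η x * B η x

/-- `q̃₁ = -q₃² / (4 q₁) + m₁' / B + (m₁ / (2 B))'`. -/
def qTilde₁ (c : ℝ) (η : ℝ → ℝ) (x : ℝ) : ℝ :=
  -(q₃ c η x ^ 2 / (4 * q₁ η x)) + deriv (m₁ η) x / B η x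
    + deriv (fun y => m₁ η y / (2 * B η y)) x

/-- `a = η' / η`. -/
def a (η : ℝ → ℝ) (x : ℝ) : ℝ := deriv η x / η x

/-- `lam = η' / (1 - η)²`. -/
def lam (η : ℝ → ℝ) (x : ℝ) : ℝ := deriv η x / (1 - η x) ^ 2

/-- The expression `-3 a' / (2 (1 - η)) - a lam / 2 - c² (η')² / ((1 - η) q₁)`. It differs from
`qTilde₁` only in the power of `1 - η` in the last term, which is `2` in `qTilde₁`. -/
def qTildeAlt₁ (c : ℝ) (η : ℝ → ℝ) (x : ℝ) : ℝ :=
  -(3 * deriv (a η) x / (2 * (1 - η x))) - a η x * lam η x / 2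
    - c ^ 2 * deriv η x ^ 2 / ((1 - η x) * q₁ η x)

end TransonicNLS

end

/-!
Write `η = 1 - |u|²` and `F = potential f`. The travelling wave equation has two first integrals,
`|u'|² - F(|u|²)` and `Im (ū u') + c η / 2`. The first one is an integrable constant, so it vanishes
(`IsTravellingWave.energy`); the second one vanishes because `|u'|²` and `η²` are integrable, hence
simultaneously small somewhere (`IsTravellingWave.momentum`). Combining them, `η` solves
`η'² = N(η)` and `η'' = N'(η) / 2` with `N(s) = 4 (1 - s) F(1 - s) - c² s²`.

Since `N(s) = O(s²)`, Grönwall's inequality shows that `η` has no zero. If `η` were negative, the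
lower bound on `F` would give `N(η) > 0`, so `η` would be monotone and `η²` not integrable; hence
`η > 0`. As `N(s) = (c_s² - c²) s² + (k / 3) s³ + o(s³)` with `k < 0`, a fixed small level `s₁`
satisfies `N(s₁) < 0` once `c` is close to `c_s`; then `η` cannot take the value `s₁`, and
integrability of `η²` forces `0 < η < s₁` (`IsTravellingWave.eta_lt_of_barrier`). Smallness of the
waves near the sound speed is thus obtained without solving the equation.

It remains to expand. With `a = η' / η` one has `a² = N(η) / η² ≤ c_s² - c²` and
`a' = (N'(η) η / 2 - N(η)) / η²`, in which the term `c² η²` cancels, so `a' / η` is close to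
`k / 6`, and at most `k / 12`, whatever the speed (`eventually_barrier_and_numerator_le`). Then
`q₁ / η = -2 (1 - η) a' / η + 2 a²` is bounded below, and in `qTilde₁ / η` and `qTildeAlt₁ / η` the
term `-3 a' / (2 η (1 - η))` dominates, all the others being `O(a²)` (`coercivity_bound`).
-/

open MeasureTheory Filter Topology Asymptotics Set

namespace TransonicNLS

/-! ### The potential and its expansion at the constant state -/

section Potential

variable {f : ℝ → ℝ}

lemma hasDerivAt_potential (hf : ContinuousOn f (Ici 0)) {ρ : ℝ} (hρ : 0 < ρ) :
    HasDerivAt (potential f) (-f ρ) ρ := by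
  have hsub : uIcc ρ 1 ⊆ Ici 0 := fun y hy =>
    (le_min hρ.le zero_le_one).trans hy.1
  exact intervalIntegral.integral_hasDerivAt_left ((hf.mono hsub).intervalIntegrable)
    ((hf.mono Ioi_subset_Ici_self).stronglyMeasurableAtFilter isOpen_Ioi ρ hρ)
    (hf.continuousAt (Ici_mem_nhds hρ))

@[simp] lemma potential_one : potential f 1 = 0 := by simp [potential]

/-- Integration of a little-o bound on the derivative, by the mean value inequality. -/
lemma isLittleO_pow_succ_of_hasDerivAt {g g' : ℝ → ℝ} {n : ℕ} (h0 : g 0 = 0)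
    (hg : ∀ᶠ s in 𝓝 0, HasDerivAt g (g' s) s) (hg' : g' =o[𝓝 0] fun s => s ^ n) :
    g =o[𝓝 0] fun s => s ^ (n + 1) := by
  rw [isLittleO_iff] at hg' ⊢
  intro c hc
  obtain ⟨r, hr, hball⟩ := Metric.eventually_nhds_iff_ball.1 (hg.and (hg' hc))
  filter_upwards [Metric.ball_mem_nhds (0 : ℝ) hr] with s hs
  have hsub : uIcc 0 s ⊆ Metric.ball (0 : ℝ) r := by
    rw [← segment_eq_uIcc]
    exact (convex_ball _ _).segment_subset (Metric.mem_ball_self hr) hs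
  have key := (convex_uIcc 0 s).norm_image_sub_le_of_norm_hasDerivWithin_le
    (f := g) (f' := g') (C := c * ‖s ^ n‖)
    (fun t ht => (hball t (hsub ht)).1.hasDerivWithinAt)
    (fun t ht => (hball t (hsub ht)).2.trans ?_) left_mem_uIcc right_mem_uIcc
  · simpa [h0, pow_succ, mul_assoc] using key
  · have : |t| ≤ |s| := by simpa using abs_sub_left_of_mem_uIcc ht
    simp only [norm_pow, Real.norm_eq_abs]
    gcongr

lemma contDiffAt_of_pos (hf : ContDiffOn ℝ 3 f (Ici 0)) {ρ : ℝ} (hρ : 0 < ρ) :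
    ContDiffAt ℝ 3 f ρ := hf.contDiffAt (Ici_mem_nhds hρ)

/-- The second order Taylor expansion of `f` at `1`, in the variable `s = 1 - ρ`. -/
lemma nonlinearity_isLittleO (hf : ContDiffOn ℝ 3 f (Ici 0)) (hf1 : f 1 = 0) :
    (fun s => f (1 - s) - (-deriv f 1 * s + deriv (deriv f) 1 * s ^ 2 / 2))
      =o[𝓝 0] fun s => s ^ 2 := by
  have hd : ∀ᶠ s : ℝ in 𝓝 0, 0 < 1 - s :=
    (continuous_const.sub continuous_id).continuousAt.eventually (lt_mem_nhds (by simp))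
  have hf2 : HasDerivAt (deriv f) (deriv (deriv f) 1) 1 := by
    have h : ContDiffOn ℝ 1 (deriv f) (Ioi 0) :=
      (hf.mono Ioi_subset_Ici_self).deriv_of_isOpen isOpen_Ioi (by norm_num)
    exact ((h.contDiffAt (Ioi_mem_nhds one_pos)).differentiableAt (by norm_num)).hasDerivAt
  refine isLittleO_pow_succ_of_hasDerivAt (n := 1)
    (g' := fun s => -deriv f (1 - s) - (-deriv f 1 + deriv (deriv f) 1 * s))
    (by simp [hf1]) ?_ ?_
  · filter_upwards [hd] with s hs
    have h1 : HasDerivAt f (deriv f (1 - s)) (1 - s) :=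
      ((contDiffAt_of_pos hf hs).differentiableAt (by norm_num)).hasDerivAt
    have h2 := h1.comp s ((hasDerivAt_id s).const_sub 1)
    have h3 := ((hasDerivAt_id s).const_mul (-deriv f 1)).add
      ((((hasDerivAt_id s).pow 2).const_mul (deriv (deriv f) 1)).div_const 2)
    refine (h2.sub h3).congr_deriv ?_
    simp
    ring
  · have h1 : HasDerivAt (fun s => -deriv f (1 - s)) (deriv (deriv f) 1) 0 := by
      have := (HasDerivAt.comp_const_sub 1 (0 : ℝ) (f := deriv f) (by rwa [sub_zero])).neg
      rw [neg_neg] at this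
      exact this
    refine (hasDerivAt_iff_isLittleO.1 h1).congr ?_ ?_
    · intro s; simp; ring
    · intro s; simp

/-- The third order Taylor expansion of the potential at `1`, in the variable `s = 1 - ρ`. -/
lemma potential_isLittleO (hf : ContDiffOn ℝ 3 f (Ici 0)) (hf1 : f 1 = 0) :
    (fun s => potential f (1 - s) - (-deriv f 1 * s ^ 2 / 2 + deriv (deriv f) 1 * s ^ 3 / 6))
      =o[𝓝 0] fun s => s ^ 3 := by
  have hd : ∀ᶠ s : ℝ in 𝓝 0, 0 < 1 - s :=
    (continuous_const.sub continuous_id).continuousAt.eventually (lt_mem_nhds (by simp))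
  refine isLittleO_pow_succ_of_hasDerivAt (n := 2) (by simp) ?_ (nonlinearity_isLittleO hf hf1)
  filter_upwards [hd] with s hs
  have h2 := (hasDerivAt_potential hf.continuousOn hs).comp s ((hasDerivAt_id s).const_sub 1)
  have h3 := ((((hasDerivAt_id s).pow 2).const_mul (-deriv f 1)).div_const 2).add
      ((((hasDerivAt_id s).pow 3).const_mul (deriv (deriv f) 1)).div_const 6)
  refine (h2.sub h3).congr_deriv ?_
  simp
  ring

end Potential

/-! ### Integrability on the line -/

/-- An integrable function on the line cannot stay above a positive constant on a set of
infinite measure. -/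
lemma not_forall_le_of_integrable {g : ℝ → ℝ} (hg : Integrable g) {S : Set ℝ}
    (hS : MeasurableSet S) (hS' : volume S = ⊤) {t : ℝ} (ht : 0 < t) : ¬ ∀ x ∈ S, t ≤ g x := by
  intro h
  have h1 : IntegrableOn (fun _ : ℝ => t) S := by
    refine Integrable.mono' hg.integrableOn aestronglyMeasurable_const ?_
    filter_upwards [ae_restrict_mem hS] with x hx
    simpa [abs_of_pos ht] using h x hx
  rw [integrableOn_const_iff] at h1
  rcases h1 with h1 | h1
  · simp at h1; exact ht.ne' h1
  · simp [hS'] at h1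

lemma exists_lt_of_integrable {g : ℝ → ℝ} (hg : Integrable g) {t : ℝ} (ht : 0 < t) :
    ∃ x, g x < t := by
  by_contra! h
  exact not_forall_le_of_integrable hg MeasurableSet.univ Real.volume_univ ht fun x _ => h x

lemma eq_of_hasDerivAt_zero {g : ℝ → ℝ} (h : ∀ x, HasDerivAt g 0 x) (x y : ℝ) : g x = g y :=
  is_const_of_deriv_eq_zero (fun x => (h x).differentiableAt) (fun x => (h x).deriv) x y

/-! ### The hydrodynamical form of the travelling wave equation -/

section Wave

variable {f : ℝ → ℝ} {c : ℝ} {u : ℝ → ℂ}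

namespace IsTravellingWave

lemma hasDerivAt_u (hu : IsTravellingWave f c u) (x : ℝ) : HasDerivAt u (deriv u x) x :=
  (hu.contDiff.differentiable (by norm_num) x).hasDerivAt

lemma hasDerivAt_deriv_u (hu : IsTravellingWave f c u) (x : ℝ) :
    HasDerivAt (deriv u) (deriv (deriv u) x) x :=
  ((contDiff_succ_iff_deriv (n := 1)).1 hu.contDiff |>.2.2.differentiable
    (by norm_num) x).hasDerivAt

end IsTravellingWave

lemma hasDerivAt_re {g : ℝ → ℂ} {g' : ℂ} {x : ℝ} (h : HasDerivAt g g' x) :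
    HasDerivAt (fun y => (g y).re) g'.re x := by
  exact Complex.reCLM.hasFDerivAt.comp_hasDerivAt x h

lemma hasDerivAt_im {g : ℝ → ℂ} {g' : ℂ} {x : ℝ} (h : HasDerivAt g g' x) :
    HasDerivAt (fun y => (g y).im) g'.im x := by
  exact Complex.imCLM.hasFDerivAt.comp_hasDerivAt x h

lemma eta_eq (u : ℝ → ℂ) (x : ℝ) : eta u x = 1 - ((u x).re ^ 2 + (u x).im ^ 2) := by
  rw [eta, Complex.sq_norm, Complex.normSq_apply]; ring

namespace IsTravellingWave

lemma eta_lt_one (hu : IsTravellingWave f c u) (x : ℝ) : eta u x < 1 := by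
  have := norm_pos_iff.2 (hu.ne_zero x)
  have : 0 < ‖u x‖ ^ 2 := by positivity
  rw [eta]; linarith

lemma equation_re (hu : IsTravellingWave f c u) (x : ℝ) :
    (deriv (deriv u) x).re = -c * (deriv u x).im - (u x).re * f (1 - eta u x) := by
  have h := congrArg Complex.re (hu.equation x)
  simp at h
  simp only [eta, sub_sub_cancel]; linarith

lemma equation_im (hu : IsTravellingWave f c u) (x : ℝ) :
    (deriv (deriv u) x).im = c * (deriv u x).re - (u x).im * f (1 - eta u x) := by
  have h := congrArg Complex.im (hu.equation x)
  simp at h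
  simp only [eta, sub_sub_cancel]; linarith

lemma hasDerivAt_eta' (hu : IsTravellingWave f c u) (x : ℝ) :
    HasDerivAt (eta u) (-2 * ((u x).re * (deriv u x).re + (u x).im * (deriv u x).im)) x := by
  have hv := hasDerivAt_re (hu.hasDerivAt_u x)
  have hw := hasDerivAt_im (hu.hasDerivAt_u x)
  rw [funext (eta_eq u)]
  refine (((hv.pow 2).add (hw.pow 2)).const_sub 1).congr_deriv ?_
  simp; ring

lemma deriv_eta (hu : IsTravellingWave f c u) (x : ℝ) :
    deriv (eta u) x = -2 * ((u x).re * (deriv u x).re + (u x).im * (deriv u x).im) :=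
  (hu.hasDerivAt_eta' x).deriv

lemma hasDerivAt_eta (hu : IsTravellingWave f c u) (x : ℝ) :
    HasDerivAt (eta u) (deriv (eta u) x) x :=
  (hu.hasDerivAt_eta' x).differentiableAt.hasDerivAt

lemma continuous_eta (hu : IsTravellingWave f c u) : Continuous (eta u) :=
  continuous_iff_continuousAt.2 fun x => (hu.hasDerivAt_eta x).continuousAt

/-- The energy density `|u'|²` equals the potential: their difference is a first integral of the
equation, and it is integrable. -/
lemma energy (hu : IsTravellingWave f c u) (hf : ContinuousOn f (Ici 0)) (x : ℝ) :
    (deriv u x).re ^ 2 + (deriv u x).im ^ 2 = potential f (1 - eta u x) := by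
  set E : ℝ → ℝ := fun x =>
    (deriv u x).re ^ 2 + (deriv u x).im ^ 2 - potential f (1 - eta u x) with hE
  have hder : ∀ y, HasDerivAt E 0 y := by
    intro y
    have hv := hasDerivAt_re (hu.hasDerivAt_deriv_u y)
    have hw := hasDerivAt_im (hu.hasDerivAt_deriv_u y)
    have hp := (hasDerivAt_potential hf (sub_pos.2 (hu.eta_lt_one y))).comp y
      ((hu.hasDerivAt_eta y).const_sub 1)
    refine (((hv.pow 2).add (hw.pow 2)).sub hp).congr_deriv ?_
    simp [hu.equation_re, hu.equation_im, hu.deriv_eta]; ring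
  have hint : Integrable E := by
    have h1 : Integrable fun x => ‖deriv u x‖ ^ 2 :=
      (memLp_two_iff_integrable_sq_norm hu.deriv_memLp.1).1 hu.deriv_memLp
    refine (h1.sub hu.potential_integrable).congr (Eventually.of_forall fun y => ?_)
    simp [hE, eta, Complex.sq_norm, Complex.normSq_apply]; ring
  have hconst : E = fun _ => E x := funext fun y => eq_of_hasDerivAt_zero hder y x
  rw [hconst, integrable_const_iff] at hint
  rcases hint with h | h
  · exact sub_eq_zero.1 h
  · exact absurd (h.measure_univ_lt_top) (by simp)

lemma integrable_eta_sq (hu : IsTravellingWave f c u) {κ : ℝ} (hκ : 0 < κ)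
    (hF : ∀ ρ : ℝ, 0 ≤ ρ → κ * (1 - ρ) ^ 2 ≤ potential f ρ) :
    Integrable fun x => eta u x ^ 2 := by
  refine (hu.potential_integrable.const_mul κ⁻¹).mono'
    (hu.continuous_eta.pow 2).aestronglyMeasurable (Eventually.of_forall fun x => ?_)
  have h := hF (‖u x‖ ^ 2) (by positivity)
  rw [Real.norm_of_nonneg (sq_nonneg _), eta, ← div_eq_inv_mul, le_div_iff₀ hκ]
  linarith

/-- The momentum density: `Im (ū u')` and `-c η / 2` differ by a constant, and both come close
to zero somewhere because `|u'|²` and `η²` are integrable. -/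
lemma momentum (hu : IsTravellingWave f c u) (hf : ContinuousOn f (Ici 0)) {κ : ℝ} (hκ : 0 < κ)
    (hF : ∀ ρ : ℝ, 0 ≤ ρ → κ * (1 - ρ) ^ 2 ≤ potential f ρ) (x : ℝ) :
    (u x).re * (deriv u x).im - (u x).im * (deriv u x).re = -c * eta u x / 2 := by
  set K : ℝ → ℝ := fun x =>
    (u x).re * (deriv u x).im - (u x).im * (deriv u x).re + c * eta u x / 2 with hK
  have hder : ∀ y, HasDerivAt K 0 y := by
    intro y
    have hv := hasDerivAt_re (hu.hasDerivAt_u y)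
    have hw := hasDerivAt_im (hu.hasDerivAt_u y)
    have hv' := hasDerivAt_re (hu.hasDerivAt_deriv_u y)
    have hw' := hasDerivAt_im (hu.hasDerivAt_deriv_u y)
    refine (((hv.mul hw').sub (hw.mul hv')).add
      (((hu.hasDerivAt_eta y).const_mul c).div_const 2)).congr_deriv ?_
    simp only [hu.equation_re, hu.equation_im, hu.deriv_eta]; ring
  have hg : Integrable fun x => potential f (1 - eta u x) + eta u x ^ 2 := by
    refine Integrable.add ?_ (hu.integrable_eta_sq hκ hF)
    simpa [eta] using hu.potential_integrable
  have hsmall : ∀ t : ℝ, 0 < t → K x ^ 2 ≤ (4 + c ^ 2) * t := by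
    intro t ht
    obtain ⟨y, hy⟩ := exists_lt_of_integrable hg (lt_min ht one_pos)
    rw [← hu.energy hf] at hy
    rw [eq_of_hasDerivAt_zero hder x y]
    have hyt := hy.trans_le (min_le_left t 1)
    have hy1 := hy.trans_le (min_le_right t 1)
    set p := (deriv u y).re
    set q := (deriv u y).im
    have hη : eta u y ^ 2 ≤ 1 := by nlinarith [sq_nonneg p, sq_nonneg q]
    have hρ : (u y).re ^ 2 + (u y).im ^ 2 ≤ 2 := by
      have h1 := eta_eq u y
      nlinarith
    -- Cauchy-Schwarz for the momentum density
    have hJ : ((u y).re * q - (u y).im * p) ^ 2 ≤ 2 * (p ^ 2 + q ^ 2) := by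
      nlinarith [sq_nonneg ((u y).re * p + (u y).im * q), sq_nonneg p, sq_nonneg q]
    have hsq : K y ^ 2 ≤ 2 * ((u y).re * q - (u y).im * p) ^ 2 + c ^ 2 * eta u y ^ 2 / 2 := by
      have := sq_nonneg ((u y).re * q - (u y).im * p - c * eta u y / 2)
      simp only [hK]; nlinarith
    nlinarith [sq_nonneg p, sq_nonneg q, sq_nonneg c, sq_nonneg (eta u y),
      mul_nonneg (sq_nonneg c) (sub_nonneg.2 hyt.le), mul_nonneg (sq_nonneg c) (sq_nonneg p),
      mul_nonneg (sq_nonneg c) (sq_nonneg q), mul_nonneg (sq_nonneg c) (sq_nonneg (eta u y))]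
  have h0 : K x ^ 2 ≤ 0 := by
    by_contra! hpos
    have hc : (0 : ℝ) < 4 + c ^ 2 := by positivity
    have h1 := hsmall (K x ^ 2 / (2 * (4 + c ^ 2))) (by positivity)
    have h2 : (4 + c ^ 2) * (K x ^ 2 / (2 * (4 + c ^ 2))) = K x ^ 2 / 2 := by field_simp
    linarith
  have h1 : K x = 0 := pow_eq_zero_iff two_ne_zero |>.1 (le_antisymm h0 (sq_nonneg _))
  simp only [hK] at h1
  linarith

/-- The first order Newton equation satisfied by `η`. -/
lemma deriv_eta_sq (hu : IsTravellingWave f c u) (hf : ContinuousOn f (Ici 0)) {κ : ℝ}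
    (hκ : 0 < κ) (hF : ∀ ρ : ℝ, 0 ≤ ρ → κ * (1 - ρ) ^ 2 ≤ potential f ρ) (x : ℝ) :
    deriv (eta u) x ^ 2
      = 4 * (1 - eta u x) * potential f (1 - eta u x) - c ^ 2 * eta u x ^ 2 := by
  have h1 := hu.momentum hf hκ hF x
  have h2 := eta_eq u x
  have h3 : c ^ 2 * eta u x ^ 2
      = 4 * ((u x).re * (deriv u x).im - (u x).im * (deriv u x).re) ^ 2 := by rw [h1]; ring
  have h4 : 1 - eta u x = (u x).re ^ 2 + (u x).im ^ 2 := by linarith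
  rw [h3, hu.deriv_eta, ← hu.energy hf, h4]
  ring

/-- The second order Newton equation satisfied by `η`. -/
lemma hasDerivAt_deriv_eta (hu : IsTravellingWave f c u) (hf : ContinuousOn f (Ici 0)) {κ : ℝ}
    (hκ : 0 < κ) (hF : ∀ ρ : ℝ, 0 ≤ ρ → κ * (1 - ρ) ^ 2 ≤ potential f ρ) (x : ℝ) :
    HasDerivAt (deriv (eta u)) (2 * (1 - eta u x) * f (1 - eta u x)
      - 2 * potential f (1 - eta u x) - c ^ 2 * eta u x) x := by
  have hv := hasDerivAt_re (hu.hasDerivAt_u x)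
  have hw := hasDerivAt_im (hu.hasDerivAt_u x)
  have hv' := hasDerivAt_re (hu.hasDerivAt_deriv_u x)
  have hw' := hasDerivAt_im (hu.hasDerivAt_deriv_u x)
  rw [funext hu.deriv_eta]
  refine (((hv.mul hv').add (hw.mul hw')).const_mul (-2)).congr_deriv ?_
  have h1 := hu.momentum hf hκ hF x
  have h2 := eta_eq u x
  rw [hu.equation_re, hu.equation_im, ← hu.energy hf]
  have h4 : c ^ 2 * eta u x
      = -2 * c * ((u x).re * (deriv u x).im - (u x).im * (deriv u x).re) := by rw [h1]; ring
  have h5 : 2 * (1 - eta u x) * f (1 - eta u x)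
      = 2 * ((u x).re ^ 2 + (u x).im ^ 2) * f (1 - eta u x) := by
    congr 2; linarith
  rw [h4, h5]
  ring

lemma continuous_deriv_eta (hu : IsTravellingWave f c u) : Continuous (deriv (eta u)) := by
  have h : ∀ x, ContinuousAt (deriv (eta u)) x := by
    intro x
    rw [funext hu.deriv_eta]
    exact continuousAt_const.mul
      (((hasDerivAt_re (hu.hasDerivAt_u x)).continuousAt.mul
        (hasDerivAt_re (hu.hasDerivAt_deriv_u x)).continuousAt).add
      ((hasDerivAt_im (hu.hasDerivAt_u x)).continuousAt.mul
        (hasDerivAt_im (hu.hasDerivAt_deriv_u x)).continuousAt))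
  exact continuous_iff_continuousAt.2 h

end IsTravellingWave

end Wave

/-! ### Sign and smallness of the hydrodynamical variable -/

/-- A function that satisfies `|η'| ≤ K |η|` wherever it is small vanishes identically as soon as
it vanishes somewhere: its zero set is open by Grönwall's inequality. -/
lemma eq_zero_of_abs_deriv_le {η : ℝ → ℝ} (hη : Differentiable ℝ η) {r K : ℝ} (hr : 0 < r)
    (hK : ∀ x, |η x| < r → |deriv η x| ≤ K * |η x|) {x₀ : ℝ} (h0 : η x₀ = 0) (x : ℝ) :
    η x = 0 := by
  have hclopen : IsClopen {x | η x = 0} := by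
    refine ⟨isClosed_eq hη.continuous continuous_const, Metric.isOpen_iff.2 fun y hy => ?_⟩
    have hy : η y = 0 := hy
    obtain ⟨ε, hε, hball⟩ := Metric.eventually_nhds_iff_ball.1
      ((hη.continuous.abs.continuousAt (x := y)).eventually
        (gt_mem_nhds (show |η y| < r by simpa [hy] using hr)))
    refine ⟨ε, hε, fun z hz => ?_⟩
    rw [Metric.mem_ball, Real.dist_eq, abs_lt] at hz
    rcases le_total y z with hyz | hyz
    · refine eq_zero_of_abs_deriv_le_mul_abs_self_of_eq_zero_right (f := η) (f' := deriv η)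
        (K := K) (a := y) (b := z) hη.continuous.continuousOn
        (fun t _ => (hη t).hasDerivAt.hasDerivWithinAt) hy (fun t ht => hK t (hball t ?_)) z
        ⟨hyz, le_rfl⟩
      rw [Metric.mem_ball, Real.dist_eq, abs_lt]
      constructor <;> linarith [ht.1, ht.2]
    · have hd : ∀ t, HasDerivAt (fun t => η (-t)) (-deriv η (-t)) t := fun t =>
        ((hη (-t)).hasDerivAt.comp t (hasDerivAt_neg t)).congr_deriv (by ring)
      have := eq_zero_of_abs_deriv_le_mul_abs_self_of_eq_zero_right (f := fun t => η (-t))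
        (f' := fun t => -deriv η (-t))
        (K := K) (a := -y) (b := -z) (hη.continuous.comp continuous_neg).continuousOn
        (fun t _ => (hd t).hasDerivWithinAt) (by simpa using hy)
        (fun t ht => by simpa using hK (-t) (hball (-t) (by
          rw [Metric.mem_ball, Real.dist_eq, abs_lt]
          constructor <;> linarith [ht.1, ht.2]))) (-z) ⟨by linarith, le_rfl⟩
      simpa using this
  have := hclopen.eq_univ ⟨x₀, h0⟩
  exact (this ▸ mem_univ x : x ∈ {x | η x = 0})

section

variable {f : ℝ → ℝ} {c : ℝ} {u : ℝ → ℂ}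

namespace IsTravellingWave

/-- A zero of `η` would force `η = 0` everywhere, hence `u' = 0`. -/
lemma eta_ne_zero (hu : IsTravellingWave f c u) (hf : ContDiffOn ℝ 3 f (Ici 0)) (hf1 : f 1 = 0)
    {κ : ℝ} (hκ : 0 < κ) (hF : ∀ ρ : ℝ, 0 ≤ ρ → κ * (1 - ρ) ^ 2 ≤ potential f ρ) (x : ℝ) :
    eta u x ≠ 0 := by
  intro hx
  obtain ⟨r, hr, hball⟩ := Metric.eventually_nhds_iff_ball.1
    (isLittleO_iff.1 (potential_isLittleO hf hf1) one_pos)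
  set C : ℝ := 1 + |deriv f 1| / 2 + |deriv (deriv f) 1| / 6 with hC
  have hC0 : 0 ≤ C := by positivity
  have hzero : ∀ y, eta u y = 0 := by
    refine eq_zero_of_abs_deriv_le (fun y => (hu.hasDerivAt_eta y).differentiableAt)
      (lt_min hr one_pos) (K := √(8 * C)) (fun y hy => ?_) hx
    have hN := hu.deriv_eta_sq hf.continuousOn hκ hF y
    have hb := hball (eta u y) (by simpa using hy.trans_le (min_le_left _ _))
    have h1 := (hy.trans_le (min_le_right _ _)).le
    set s := eta u y
    have hs3 : |s| ^ 3 ≤ s ^ 2 := by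
      rw [← sq_abs s]; exact pow_le_pow_of_le_one (abs_nonneg s) h1 (by norm_num)
    have hΦ : |potential f (1 - s)| ≤ C * s ^ 2 := by
      have e1 : |-deriv f 1 * s ^ 2 / 2| = |deriv f 1| / 2 * s ^ 2 := by
        rw [abs_div, abs_mul, abs_neg, abs_of_nonneg (sq_nonneg s)]; norm_num; ring
      have e2 : |deriv (deriv f) 1 * s ^ 3 / 6| ≤ |deriv (deriv f) 1| / 6 * s ^ 2 := by
        rw [abs_div, abs_mul, abs_pow]; norm_num
        nlinarith [abs_nonneg (deriv (deriv f) 1)]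
      simp only [Real.norm_eq_abs, one_mul, abs_pow] at hb
      have e3 := abs_sub_abs_le_abs_sub (potential f (1 - s))
        (-deriv f 1 * s ^ 2 / 2 + deriv (deriv f) 1 * s ^ 3 / 6)
      have e4 := abs_add_le (-deriv f 1 * s ^ 2 / 2) (deriv (deriv f) 1 * s ^ 3 / 6)
      rw [hC]; linarith
    refine abs_le_of_sq_le_sq' ?_ (by positivity) |> abs_le.2
    rw [hN, mul_pow, Real.sq_sqrt (by positivity), sq_abs]
    have h2 : (1 - s) * potential f (1 - s) ≤ 2 * (C * s ^ 2) := by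
      refine (le_abs_self _).trans ?_
      rw [abs_mul]
      refine mul_le_mul ?_ hΦ (abs_nonneg _) two_pos.le
      rw [abs_le] at h1 ⊢
      constructor <;> linarith
    nlinarith [mul_nonneg (sq_nonneg c) (sq_nonneg s)]
  have hdu : ∀ y, HasDerivAt u 0 y := by
    intro y
    have hE := hu.energy hf.continuousOn y
    rw [hzero y, sub_zero, potential_one] at hE
    have : deriv u y = 0 := by
      apply Complex.ext
      · simp; nlinarith [sq_nonneg (deriv u y).re, sq_nonneg (deriv u y).im]
      · simp; nlinarith [sq_nonneg (deriv u y).re, sq_nonneg (deriv u y).im]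
    rw [← this]; exact hu.hasDerivAt_u y
  obtain ⟨y, z, hyz⟩ := hu.nonconstant
  exact hyz (is_const_of_deriv_eq_zero (fun y => (hdu y).differentiableAt)
    (fun y => (hdu y).deriv) y z)

/-- A negative `η` would have no critical point, so it would be monotone, which contradicts the
integrability of `η²`. -/
lemma eta_pos (hu : IsTravellingWave f c u) (hf : ContDiffOn ℝ 3 f (Ici 0)) (hf1 : f 1 = 0)
    {κ : ℝ} (hκ : 0 < κ) (hF : ∀ ρ : ℝ, 0 ≤ ρ → κ * (1 - ρ) ^ 2 ≤ potential f ρ)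
    (hc : c ^ 2 < 4 * κ) (x : ℝ) : 0 < eta u x := by
  have hne := hu.eta_ne_zero hf hf1 hκ hF
  by_contra! hx
  have hneg : ∀ y, eta u y < 0 := by
    intro y
    by_contra! hy
    obtain ⟨z, hz⟩ := mem_range_of_exists_le_of_exists_ge hu.continuous_eta ⟨x, hx⟩ ⟨y, hy⟩
    exact hne z hz
  have hder : ∀ y, deriv (eta u) y ≠ 0 := by
    intro y hy
    have hN := hu.deriv_eta_sq hf.continuousOn hκ hF y
    have hs := hneg y
    have hp := hF (1 - eta u y) (by linarith)
    rw [hy] at hN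
    set s := eta u y
    have h1 : 0 < s ^ 2 := sq_pos_of_neg hs
    have h2 : κ * s ^ 2 ≤ potential f (1 - s) := by simpa using hp
    have h3 : 0 ≤ potential f (1 - s) := le_trans (by positivity) h2
    nlinarith [mul_nonneg (neg_nonneg.2 hs.le) h3]
  have hint := hu.integrable_eta_sq hκ hF
  have hsq : 0 < eta u 0 ^ 2 := by have := hne 0; positivity
  by_cases hs : ∃ y, 0 < deriv (eta u) y
  · have hpos : ∀ y, 0 < deriv (eta u) y := by
      intro y
      by_contra! hy
      obtain ⟨z, hz⟩ := mem_range_of_exists_le_of_exists_ge hu.continuous_deriv_eta ⟨y, hy⟩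
        (hs.imp fun _ h => h.le)
      exact hder z hz
    refine not_forall_le_of_integrable hint measurableSet_Iic (Real.volume_Iic (a := 0)) hsq
      fun y hy => ?_
    have := (strictMono_of_deriv_pos hpos).monotone hy
    nlinarith [hneg y, hneg 0]
  · push Not at hs
    refine not_forall_le_of_integrable hint measurableSet_Ici (Real.volume_Ici (a := 0)) hsq
      fun y hy => ?_
    have := (strictAnti_of_deriv_neg fun z => (hs z).lt_of_ne (hder z)).antitone hy
    nlinarith [hneg y, hneg 0]

/-- A level `s₁ > 0` at which the right-hand side of the first order equation is negative is a
barrier for `η`. -/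
lemma eta_lt_of_barrier (hu : IsTravellingWave f c u) (hf : ContinuousOn f (Ici 0))
    {κ : ℝ} (hκ : 0 < κ) (hF : ∀ ρ : ℝ, 0 ≤ ρ → κ * (1 - ρ) ^ 2 ≤ potential f ρ)
    {s₁ : ℝ} (hs₁ : 0 < s₁) (hbar : 4 * (1 - s₁) * potential f (1 - s₁) < c ^ 2 * s₁ ^ 2) (x : ℝ) :
    eta u x < s₁ := by
  by_contra! hx
  obtain ⟨y, hy⟩ := exists_lt_of_integrable (hu.integrable_eta_sq hκ hF)
    (show 0 < s₁ ^ 2 by positivity)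
  obtain ⟨z, hz⟩ := mem_range_of_exists_le_of_exists_ge hu.continuous_eta
    ⟨y, (abs_lt_of_sq_lt_sq' hy hs₁.le).2.le⟩ ⟨x, hx⟩
  have hN := hu.deriv_eta_sq hf hκ hF z
  rw [hz] at hN
  nlinarith [sq_nonneg (deriv (eta u) z)]

end IsTravellingWave

/-! ### The small amplitude regime -/

/-- Consequences of the Taylor expansions near `s = 0`, where `k = 2 f''(1) + 6 f'(1)` is the
leading coefficient in both: the right-hand side of the first order equation at the sonic speed is
negative, and the numerator of `(η' / η)' = (η'' η - η'²) / η²` is at most `k s³ / 12`. -/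
lemma eventually_barrier_and_numerator_le (hf : ContDiffOn ℝ 3 f (Ici 0)) (hf1 : f 1 = 0)
    (hk : 2 * deriv (deriv f) 1 + 6 * deriv f 1 < 0) :
    ∀ᶠ s in 𝓝[>] (0 : ℝ),
      4 * (1 - s) * potential f (1 - s) < -2 * deriv f 1 * s ^ 2 ∧
      2 * (1 - s) * s * f (1 - s) - 4 * potential f (1 - s) + 2 * s * potential f (1 - s)
        ≤ (2 * deriv (deriv f) 1 + 6 * deriv f 1) / 12 * s ^ 3 := by
  set d := deriv f 1
  set r := deriv (deriv f) 1
  obtain ⟨τ, hτ0, hτ⟩ : ∃ τ : ℝ, 0 < τ ∧ 2 * r + 6 * d = -12 * τ :=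
    ⟨-(2 * r + 6 * d) / 12, by linarith, by ring⟩
  have hr : ∀ᶠ s : ℝ in 𝓝 0, |r| * s < τ / 4 :=
    (continuous_const.mul continuous_id).continuousAt.eventually
      (gt_mem_nhds (by simpa using hτ0))
  have e1 := isLittleO_iff.1 (nonlinearity_isLittleO hf hf1) (show 0 < τ / 16 by positivity)
  have e2 := isLittleO_iff.1 (potential_isLittleO hf hf1) (show 0 < τ / 16 by positivity)
  filter_upwards [nhdsWithin_le_nhds hr, nhdsWithin_le_nhds e1, nhdsWithin_le_nhds e2,
    nhdsWithin_le_nhds (gt_mem_nhds (one_pos : (0 : ℝ) < 1)), self_mem_nhdsWithin]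
    with s hr h1 h2 hs1 hs
  have hs : 0 < s := hs
  rw [Real.norm_eq_abs, Real.norm_of_nonneg (by positivity)] at h1 h2
  obtain ⟨x, hx⟩ : ∃ x, f (1 - s) = -d * s + r * s ^ 2 / 2 + x :=
    ⟨_, (add_sub_cancel _ _).symm⟩
  obtain ⟨y, hy⟩ : ∃ y, potential f (1 - s) = -d * s ^ 2 / 2 + r * s ^ 3 / 6 + y :=
    ⟨_, (add_sub_cancel _ _).symm⟩
  rw [hx, add_sub_cancel_left, abs_le] at h1
  rw [hy, add_sub_cancel_left, abs_le] at h2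
  have hd : d = -2 * τ - r / 3 := by linarith
  have hs3 : 0 < s ^ 3 := by positivity
  have hr1 : r * s ≤ τ / 4 := (mul_le_mul_of_nonneg_right (le_abs_self r) hs.le).trans hr.le
  have hr2 : -(τ / 4) ≤ r * s := by
    have := mul_le_mul_of_nonneg_right (neg_abs_le r) hs.le
    linarith
  have hr1' := mul_le_mul_of_nonneg_left hr1 hs3.le
  have hr2' := mul_le_mul_of_nonneg_left hr2 hs3.le
  have hτs : 0 < τ * s ^ 3 := by positivity
  rw [hx, hy, hd]
  constructor
  · have hy' : (1 - s) * y ≤ τ / 16 * s ^ 3 := by nlinarith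
    linear_combination 4 * hy' + 2 / 3 * hr2' + 43 / 12 * hτs
  · have hx' : (1 - s) * s * x ≤ τ / 16 * s ^ 3 := by
      have : s * x ≤ τ / 16 * s ^ 3 := by nlinarith
      nlinarith
    have hy' : (-4 + 2 * s) * y ≤ 4 * (τ / 16 * s ^ 3) := by nlinarith
    linear_combination 2 * hx' + hy' + 2 / 3 * hr2' + 11 / 24 * hτs

/-- The elementary inequality behind the coercivity bounds. Here `s`, `p`, `b` stand for `η`,
`η' / η` and `-(η' / η)' / η`; the exponent `j` is the power of `1 - η` in the last term,
`2` for `qTilde₁` and `1` for `qTildeAlt₁`. -/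
lemma coercivity_bound {s p b c cs κ τ : ℝ} {j : ℕ} (hs0 : 0 < s) (hs : s ≤ 1 / 2) (hκ : 0 < κ)
    (hb : κ / 12 ≤ b) (hp : p ^ 2 ≤ τ) (hc : c ^ 2 ≤ cs ^ 2)
    (hτ : 2 * τ + 48 * cs ^ 2 * τ / κ ≤ κ / 16) (hj : j ≤ 2) :
    κ / 16 ≤ 3 * b / (2 * (1 - s)) - p ^ 2 / (2 * (1 - s) ^ 2)
      - c ^ 2 * p ^ 2 / ((1 - s) ^ j * (2 * (b * (1 - s) + p ^ 2))) := by
  have h1s : 1 / 2 ≤ 1 - s := by linarith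
  have hb0 : 0 < b := by linarith
  have t1 : κ / 8 ≤ 3 * b / (2 * (1 - s)) := by
    rw [le_div_iff₀ (by linarith)]; nlinarith
  have h4 : 1 / 4 ≤ (1 - s) ^ 2 := by nlinarith
  have t2 : p ^ 2 / (2 * (1 - s) ^ 2) ≤ 2 * τ := by
    rw [div_le_iff₀ (by linarith)]; nlinarith [sq_nonneg p]
  have hj4 : 1 / 4 ≤ (1 - s) ^ j := h4.trans (pow_le_pow_of_le_one (by linarith) (by linarith) hj)
  have hQ : κ / 12 ≤ 2 * (b * (1 - s) + p ^ 2) := by nlinarith [sq_nonneg p]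
  have hτ0 : 0 ≤ τ := (sq_nonneg p).trans hp
  have t3 : c ^ 2 * p ^ 2 / ((1 - s) ^ j * (2 * (b * (1 - s) + p ^ 2)))
      ≤ cs ^ 2 * τ / (1 / 4 * (κ / 12)) := by gcongr
  have e : cs ^ 2 * τ / (1 / 4 * (κ / 12)) = 48 * cs ^ 2 * τ / κ := by field_simp; ring
  linarith

/-- The left-hand side of `coercivity_bound` as a quotient by `s`, with `w = 1 - s` and `s Q` in
the role of `q₁`. -/
lemma virial_rescale {s p b c w Q : ℝ} {j : ℕ} (hs : s ≠ 0) (hw : w ≠ 0) (hQ : Q ≠ 0) :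
    3 * b / (2 * w) - p ^ 2 / (2 * w ^ 2) - c ^ 2 * p ^ 2 / (w ^ j * Q)
      = (-(3 * -(b * s) / (2 * w)) - p * (p * s) / (2 * w ^ 2)
        - c ^ 2 * (p * s) ^ 2 / (w ^ j * (s * Q))) / s := by
  field_simp

/-! ### The virial coefficients in terms of the logarithmic derivative -/

section Virial

variable {η : ℝ → ℝ} {x : ℝ} {A : ℝ}

lemma hasDerivAt_m₁ (hA : HasDerivAt (a η) A x) : HasDerivAt (m₁ η) (-A) x := hA.neg

lemma q₁_eq (hη : HasDerivAt η (deriv η x) x) (hA : HasDerivAt (a η) A x) :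
    q₁ η x = 2 * (-A * (1 - η x) + a η x * deriv η x) := by
  have h := (hasDerivAt_m₁ hA).mul (hη.const_sub 1)
  have h' : HasDerivAt (fun y => m₁ η y * B η y) _ x := h
  rw [q₁, h'.deriv, m₁, a]
  ring

/-- The expression for `qTilde₁` in terms of `a = η' / η`, obtained by expanding the two
derivatives; it shows that the last term carries the power `2` of `1 - η`. -/
lemma qTilde₁_eq (c : ℝ) (hη : HasDerivAt η (deriv η x) x) (hA : HasDerivAt (a η) A x)
    (h1 : η x < 1) :
    qTilde₁ c η x = -(3 * A / (2 * (1 - η x))) - a η x * deriv η x / (2 * (1 - η x) ^ 2)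
      - c ^ 2 * deriv η x ^ 2 / ((1 - η x) ^ 2 * q₁ η x) := by
  have hne : 1 - η x ≠ 0 := by linarith
  have h := (hasDerivAt_m₁ hA).div ((hη.const_sub 1).const_mul 2)
    (mul_ne_zero two_ne_zero hne)
  have h' : HasDerivAt (fun y => m₁ η y / (2 * B η y)) _ x := h
  have hq : q₃ c η x ^ 2 / (4 * q₁ η x)
      = c ^ 2 * deriv η x ^ 2 / ((1 - η x) ^ 2 * q₁ η x) := by
    rw [q₃, m₂, B]
    rcases eq_or_ne (q₁ η x) 0 with h0 | h0
    · simp [h0]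
    · field_simp; ring
  rw [qTilde₁, hq, h'.deriv, (hasDerivAt_m₁ hA).deriv, m₁, a, B]
  field_simp
  ring

end Virial

end

end TransonicNLS

open TransonicNLS in
theorem mainTheorem10 (f : ℝ → ℝ)
    (hf : ContDiffOn ℝ 3 f (Set.Ici 0))
    (hf1 : f 1 = 0)
    (hdf1 : deriv f 1 < 0)
    (hF : ∀ ρ : ℝ, 0 ≤ ρ →
      TransonicNLS.soundSpeed f ^ 2 / 4 * (1 - ρ) ^ 2 ≤ TransonicNLS.potential f ρ)
    (hk : 2 * deriv (deriv f) 1 + 6 * deriv f 1 < 0)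
    (c₀ : ℝ) (hc₀ : 0 < c₀) (hc₀s : c₀ < TransonicNLS.soundSpeed f) :
    ∃ c₁ : ℝ, c₀ < c₁ ∧ c₁ < TransonicNLS.soundSpeed f ∧
      (∀ c : ℝ, c₁ < c → c < TransonicNLS.soundSpeed f →
        ∀ u : ℝ → ℂ, TransonicNLS.IsTravellingWave f c u → ∀ x : ℝ,
          0 < TransonicNLS.q₁ (TransonicNLS.eta u) x / TransonicNLS.eta u x) ∧
      ∃ δ : ℝ, 0 < δ ∧
        ∀ c : ℝ, c₁ < c → c < TransonicNLS.soundSpeed f →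
          ∀ u : ℝ → ℂ, TransonicNLS.IsTravellingWave f c u → ∀ x : ℝ,
            δ ≤ TransonicNLS.qTilde₁ c (TransonicNLS.eta u) x / TransonicNLS.eta u x ∧
            δ ≤ TransonicNLS.qTildeAlt₁ c (TransonicNLS.eta u) x / TransonicNLS.eta u x := by
  have hcs2 : soundSpeed f ^ 2 = -2 * deriv f 1 := Real.sq_sqrt (by linarith)
  set cs := soundSpeed f
  have hcs : 0 < cs := hc₀.trans hc₀s
  have hκ₀ : 0 < cs ^ 2 / 4 := by positivity
  obtain ⟨κ, hκ, hkκ⟩ : ∃ κ : ℝ, 0 < κ ∧ 2 * deriv (deriv f) 1 + 6 * deriv f 1 = -κ :=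
    ⟨_, neg_pos.2 hk, (neg_neg _).symm⟩
  obtain ⟨s₁, hs₁, hs₁0, hsmall⟩ : ∃ s₁ : ℝ, s₁ ≤ 1 / 2 ∧ 0 < s₁ ∧ ∀ s, 0 < s → s ≤ s₁ →
      4 * (1 - s) * potential f (1 - s) < cs ^ 2 * s ^ 2 ∧
      2 * (1 - s) * s * f (1 - s) - 4 * potential f (1 - s) + 2 * s * potential f (1 - s)
        ≤ -κ / 12 * s ^ 3 := by
    have h := eventually_barrier_and_numerator_le hf hf1 hk
    rw [← hcs2, hkκ] at h
    obtain ⟨b, hb, hb'⟩ := (mem_nhdsGT_iff_exists_Ioc_subset).1 h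
    have hb : 0 < b := hb
    exact ⟨min b (1 / 2), min_le_right _ _, lt_min hb (by norm_num),
      fun s h0 hs => hb' ⟨h0, hs.trans (min_le_left _ _)⟩⟩
  -- `τ` bounds `(η' / η)²`; this value gives equality in the smallness condition `hτ`.
  set τ : ℝ := κ ^ 2 / (16 * (2 * κ + 48 * cs ^ 2)) with hτdef
  have hτ0 : 0 < τ := by positivity
  have hτ : 2 * τ + 48 * cs ^ 2 * τ / κ ≤ κ / 16 := by
    rw [hτdef]; apply le_of_eq; field_simp
  -- `c₁` is close enough to the sound speed for `s₁` to be a barrier and `c_s² - c₁² < τ`.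
  obtain ⟨c₁, ⟨⟨hc₀₁, hc₁bar⟩, hc₁τ⟩, hc₁s⟩ : ∃ c₁ : ℝ, ((c₀ < c₁ ∧
      4 * (1 - s₁) * potential f (1 - s₁) < c₁ ^ 2 * s₁ ^ 2) ∧ cs ^ 2 - τ < c₁ ^ 2) ∧ c₁ < cs := by
    have h1 : ∀ᶠ c in 𝓝 cs, 4 * (1 - s₁) * potential f (1 - s₁) < c ^ 2 * s₁ ^ 2 :=
      ((continuous_id.pow 2).mul continuous_const).continuousAt.eventually
        (lt_mem_nhds (hsmall s₁ hs₁0 le_rfl).1)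
    have h2 : ∀ᶠ c in 𝓝 cs, cs ^ 2 - τ < c ^ 2 :=
      (continuous_id.pow 2).continuousAt.eventually
        (lt_mem_nhds (show cs ^ 2 - τ < id cs ^ 2 by simpa using hτ0))
    exact ((((lt_mem_nhds hc₀s).and h1).and h2).filter_mono nhdsWithin_le_nhds
      |>.and (self_mem_nhdsWithin : Iio cs ∈ 𝓝[<] cs)).exists
  -- `s`, `p`, `b` below are `η`, `η' / η` and `-(η' / η)' / η` at the point `x`.
  have key : ∀ c : ℝ, c₁ < c → c < cs → ∀ u : ℝ → ℂ, IsTravellingWave f c u → ∀ x : ℝ,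
      0 < q₁ (eta u) x / eta u x ∧ κ / 16 ≤ qTilde₁ c (eta u) x / eta u x ∧
        κ / 16 ≤ qTildeAlt₁ c (eta u) x / eta u x := by
    intro c hc hcs' u hu x
    have hc2 : c₁ ^ 2 < c ^ 2 := by nlinarith
    have hcs2' : c ^ 2 < cs ^ 2 := by nlinarith
    have hfc := hf.continuousOn
    have hpos := hu.eta_pos hf hf1 hκ₀ hF (by linarith) x
    have hlt := hu.eta_lt_of_barrier hfc hκ₀ hF hs₁0 (by nlinarith [sq_nonneg s₁]) x
    obtain ⟨hG, hnum⟩ := hsmall _ hpos hlt.le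
    have hN := hu.deriv_eta_sq hfc hκ₀ hF x
    have hη := hu.hasDerivAt_eta x
    have hA' := (hu.hasDerivAt_deriv_eta hfc hκ₀ hF x).div hη hpos.ne'
    obtain ⟨A, hAeq⟩ : ∃ A, A = _ := ⟨_, rfl⟩
    have hA : HasDerivAt (a (eta u)) A x := by rw [hAeq]; exact hA'
    obtain ⟨s, hs⟩ : ∃ s, s = eta u x := ⟨_, rfl⟩
    obtain ⟨p, hp⟩ : ∃ p, p = a (eta u) x := ⟨_, rfl⟩
    obtain ⟨b, hb⟩ : ∃ b, b = -A / s := ⟨_, rfl⟩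
    have hd : deriv (eta u) x = p * s := by rw [hp, hs, a]; field_simp
    rw [← hs] at hpos hlt hG hnum hN hAeq
    have hAb : A = -(b * s) := by rw [hb]; field_simp
    -- the term `c² η²` cancels in `η'' η - η'²`, so the bound on `b` does not involve `c`
    have hbκ : κ / 12 ≤ b := by
      have h3 : 0 < s ^ 3 := by positivity
      rw [hd] at hN
      rw [hd, eq_div_iff (by positivity), hAb] at hAeq
      refine le_of_mul_le_mul_right ?_ h3
      nlinarith
    -- `(η' / η)² = 4 (1 - η) F(1 - η) / η² - c²` is at most `c_s² - c²`
    have hpτ : p ^ 2 ≤ τ := by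
      have h2 : 0 < s ^ 2 := by positivity
      rw [hd] at hN
      refine le_of_mul_le_mul_right ?_ h2
      nlinarith
    have hsh : s ≤ 1 / 2 := hlt.le.trans hs₁
    have h1s : 0 < 1 - s := by linarith
    have hb0 : 0 < b := by linarith [div_pos hκ (show (0 : ℝ) < 12 by norm_num)]
    have hq : q₁ (eta u) x = s * (2 * (b * (1 - s) + p ^ 2)) := by
      rw [q₁_eq hη hA, ← hs, ← hp, hd, hAb]; ring
    have hQ : 0 < 2 * (b * (1 - s) + p ^ 2) := by positivity
    refine ⟨?_, ?_, ?_⟩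
    · rw [hq, ← hs]; positivity
    · refine (coercivity_bound hpos hsh hκ hbκ hpτ hcs2'.le hτ (le_refl 2)).trans_eq ?_
      rw [qTilde₁_eq c hη hA (by linarith), hq, ← hs, ← hp, hd, hAb]
      exact virial_rescale hpos.ne' h1s.ne' hQ.ne'
    · refine (coercivity_bound hpos hsh hκ hbκ hpτ hcs2'.le hτ (one_le_two)).trans_eq ?_
      have e : p * (p * s / (1 - s) ^ 2) / 2 = p * (p * s) / (2 * (1 - s) ^ 2) := by
        field_simp
      rw [qTildeAlt₁, hA.deriv, lam, hq, ← hs, ← hp, hd, hAb, e,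
        virial_rescale hpos.ne' h1s.ne' hQ.ne', pow_one]
  exact ⟨c₁, hc₀₁, hc₁s, fun c h1 h2 u hu x => (key c h1 h2 u hu x).1, κ / 16, by positivity,
    fun c h1 h2 u hu x => (key c h1 h2 u hu x).2⟩
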